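/- Let $n\ge 1$, let $\mathbb F_n^+$ be the free monoid on generators $g_1,\dots,g_n$ with identity $g_0$ and length function $|\alpha|$, and for an $n$-tuple $T=(T_1,\dots,T_n)$ of bounded operators on a complex Hilbert space $\mathcal H$ put $T_\alpha:=T_{i_1}\cdots T_{i_k}$ for $\alpha=g_{i_1}\cdots g_{i_k}$ and $T_{g_0}:=I$. Let $p=\sum_{1\le|\alpha|\le m}a_\alpha X_\alpha$ be a positive regular noncommutative polynomial, i.e. $a_\alpha\ge 0$ for all $\alpha$ and $a_{g_i}>0$ for $i=1,\dots,n$. Define $$b_{g_0}:=1,\qquad b_\alpha:=\sum_{j=1}^{|\alpha|}\ \sum_{\gamma_1\cdots\gamma_j=\alpha,\ |\gamma_1|\ge1,\dots,|\gamma_j|\ge 1}a_{\gamma_1}\cdots a_{\gamma_j}\quad(|\alpha|\ge1),\qquad \gamma:=\sum_{1\le|\alpha|\le m}\frac{a_\alpha}{b_\alpha}.$$ For $T\in B(\mathcal H)^n$ let $\Phi_{p,T}(X):=\sum_{1\le|\alpha|\le m}a_\alpha T_\alpha XT_\alpha^*$, $X\in B(\mathcal H)$, and let $\mathcal D_p(\mathcal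 H)$ be the set of all $T\in B(\mathcal H)^n$ with $\|\Phi_{p,T}(I)\|\le 1$. Let $F^2(H_n)$ be the full Fock space with its orthonormal basis $(e_\alpha)_{\alpha\in\mathbb F_n^+}$, and let $W=(W_1,\dots,W_n)$ be the weighted left creation operators on it, $W_ie_\alpha=\sqrt{b_\alpha/b_{g_i\alpha}}\;e_{g_i\alpha}$. For $T\in\mathcal D_p(\mathcal H)$ let $\Delta_{p,T}:=(I-\Phi_{p,T}(I))^{1/2}$ and let the Poisson kernel $K_{p,T}:\mathcal H\to F^2(H_n)\otimes\overline{\Delta_{p,T}\mathcal H}$ be the bounded operator $$K_{p,T}h=\sum_{\alpha\in\mathbb F_n^+}\sqrt{b_\alpha}\,e_\alpha\otimes\Delta_{p,T}T_\alpha^*h .$$ **Theorem.** Let $p$ be a positive regular noncommutative polynomial and let $T\in\mathcal D_p(\mathcal H)$. Then for every $k\ge 0$ the operator $K_{p,T}^*\big[I-\Phi_{p,W}^{k+1}(I)\otimes I_{\overline{\Delta_{p,T}\mathcal H}}\big]K_{p,T}$ is positive, so that it has a trace in $[0,\infty]$, and the limit $$\mathrm{curv}_p(T):=\lim_{k\to\infty}\frac{\mathrm{trace}\big\{K_{p,T}^*\big[I-\Phi_{p,W}^{k+1}(I)\otimes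 I_{\overline{\Delta_{p,T}\mathcal H}}\big]K_{p,T}\big\}}{\sum_{j=0}^k\gamma^j}$$ exists in $[0,\infty]$. Moreover, $\mathrm{curv}_p(T)<\infty$ if and only if $\mathrm{trace}(I-\Phi_{p,T}(I))<\infty$, and $\mathrm{curv}_p(T)\le\mathrm{trace}(I-\Phi_{p,T}(I))$. -/

import Mathlib

open scoped ENNReal InnerProductSpace TensorProduct Topology
open Filter

noncomputable section

namespace NCDomain

/-! ### Positive regular polynomials and the coefficients `b_α` -/

/-- A positive regular noncommutative polynomial `p = ∑_{1 ≤ |α| ≤ m} a_α X_α` in `n`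
indeterminates: an element of the monoid algebra of the free monoid on `n` generators with
nonnegative coefficients `a_α`, with `a_{g_0} = 0` and `a_{g_i} > 0` for every generator `g_i`. -/
structure PosRegPoly (n : ℕ) where
  toPoly : MonoidAlgebra ℝ (FreeMonoid (Fin n))
  coeff_nonneg : ∀ α, 0 ≤ toPoly.coeff α
  coeff_one : toPoly.coeff 1 = 0
  coeff_of_pos : ∀ i, 0 < toPoly.coeff (FreeMonoid.of i)

variable {n : ℕ}

/-- The coefficient `a_α` of `p`. -/
def PosRegPoly.a (p : PosRegPoly n) (α : FreeMonoid (Fin n)) : ℝ := p.toPoly.coeff α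

/-- The coefficients `b_α` of `(1 - p)⁻¹ = 1 + p + p² + ⋯`: since the coefficient of `X_α` in `p ^ j`
is `∑_{γ_1 ⋯ γ_j = α, |γ_1| ≥ 1, …, |γ_j| ≥ 1} a_{γ_1} ⋯ a_{γ_j}`
(which vanishes for `j > |α|`, and for `j = 0` if `|α| ≥ 1`), this is `b_{g_0} = 1` and
`b_α = ∑_{j=1}^{|α|} ∑_{γ_1 ⋯ γ_j = α} a_{γ_1} ⋯ a_{γ_j}` if `|α| ≥ 1`. -/
def PosRegPoly.b (p : PosRegPoly n) (α : FreeMonoid (Fin n)) : ℝ :=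
  ∑ j ∈ Finset.range (α.length + 1), (p.toPoly ^ j).coeff α

/-- The number `γ = ∑_{1 ≤ |α| ≤ m} a_α / b_α`. -/
def PosRegPoly.gamma (p : PosRegPoly n) : ℝ :=
  ∑ α ∈ p.toPoly.coeff.support, p.a α / p.b α

/-- Products of polynomials with nonnegative coefficients have nonnegative coefficients, and are
bounded below by any single term. -/
lemma coeff_mul_ge {x y : MonoidAlgebra ℝ (FreeMonoid (Fin n))}
    (hx : ∀ α, 0 ≤ x.coeff α) (hy : ∀ α, 0 ≤ y.coeff α) (α β : FreeMonoid (Fin n)) :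
    x.coeff α * y.coeff β ≤ (x * y).coeff (α * β) := by
  classical
  rw [MonoidAlgebra.coeff_mul]
  have hterm : ∀ m₁ m₂, 0 ≤ if m₁ * m₂ = α * β then x.coeff m₁ * y.coeff m₂ else 0 := by
    intro m₁ m₂
    split_ifs
    · exact mul_nonneg (hx _) (hy _)
    · exact le_rfl
  by_cases hα : α ∈ x.coeff.support
  · by_cases hβ : β ∈ y.coeff.support
    · refine le_trans ?_ (Finset.single_le_sum
        (f := fun m₁ => y.coeff.sum fun m₂ r₂ => if m₁ * m₂ = α * β then x.coeff m₁ * r₂ else 0)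
        (fun m₁ _ => Finset.sum_nonneg fun m₂ _ => hterm m₁ m₂) hα)
      refine le_trans ?_ (Finset.single_le_sum
        (f := fun m₂ => if α * m₂ = α * β then x.coeff α * y.coeff m₂ else 0)
        (fun m₂ _ => hterm α m₂) hβ)
      simp
    · rw [Finsupp.notMem_support_iff.1 hβ, mul_zero]
      exact Finset.sum_nonneg fun m₁ _ => Finset.sum_nonneg fun m₂ _ => hterm m₁ m₂
  · rw [Finsupp.notMem_support_iff.1 hα, zero_mul]
    exact Finset.sum_nonneg fun m₁ _ => Finset.sum_nonneg fun m₂ _ => hterm m₁ m₂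

lemma coeff_mul_nonneg {x y : MonoidAlgebra ℝ (FreeMonoid (Fin n))}
    (hx : ∀ α, 0 ≤ x.coeff α) (hy : ∀ α, 0 ≤ y.coeff α) (α : FreeMonoid (Fin n)) :
    0 ≤ (x * y).coeff α := by
  have := coeff_mul_ge hx hy α 1
  rw [mul_one] at this
  exact le_trans (mul_nonneg (hx _) (hy _)) this

lemma PosRegPoly.coeff_pow_nonneg (p : PosRegPoly n) (j : ℕ) (α : FreeMonoid (Fin n)) :
    0 ≤ (p.toPoly ^ j).coeff α := by
  induction j generalizing α with
  | zero =>
    classical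
    rw [pow_zero, MonoidAlgebra.one_def, MonoidAlgebra.coeff_single, Finsupp.single_apply]
    split_ifs <;> norm_num
  | succ j ih =>
    rw [pow_succ']
    exact coeff_mul_nonneg p.coeff_nonneg ih α

lemma PosRegPoly.b_one (p : PosRegPoly n) : p.b 1 = 1 := by
  simp [PosRegPoly.b, MonoidAlgebra.one_def, MonoidAlgebra.coeff_single]

lemma PosRegPoly.b_nonneg (p : PosRegPoly n) (α : FreeMonoid (Fin n)) : 0 ≤ p.b α :=
  Finset.sum_nonneg fun j _ => p.coeff_pow_nonneg j α

/-- `a_{g_i} b_α ≤ b_{g_i α}`. -/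
lemma PosRegPoly.a_mul_b_le (p : PosRegPoly n) (i : Fin n) (α : FreeMonoid (Fin n)) :
    p.a (FreeMonoid.of i) * p.b α ≤ p.b (FreeMonoid.of i * α) := by
  have hl : (FreeMonoid.of i * α).length + 1 = (α.length + 1) + 1 := by
    simp [FreeMonoid.length_mul, add_comm]
  unfold PosRegPoly.b
  rw [hl, Finset.mul_sum, Finset.sum_range_succ' _ (α.length + 1)]
  refine le_trans ?_ (le_add_of_nonneg_right (p.coeff_pow_nonneg 0 _))
  refine Finset.sum_le_sum fun j _ => ?_
  rw [pow_succ']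
  exact coeff_mul_ge p.coeff_nonneg (p.coeff_pow_nonneg j) _ _

lemma PosRegPoly.b_pos (p : PosRegPoly n) (α : FreeMonoid (Fin n)) : 0 < p.b α := by
  induction α using FreeMonoid.inductionOn' with
  | one => rw [p.b_one]; exact one_pos
  | of_mul i α ih => exact lt_of_lt_of_le (mul_pos (p.coeff_of_pos i) ih) (p.a_mul_b_le i α)

/-! ### The completely positive map `Φ_{p,T}` and the noncommutative domain -/

section Domain

variable {H : Type*} [NormedAddCommGroup H] [InnerProductSpace ℂ H] [CompleteSpace H]

/-- `T_α = T_{i_1} ⋯ T_{i_k}` for `α = g_{i_1} ⋯ g_{i_k}`, and `T_{g_0} = I`. -/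
def word (T : Fin n → H →L[ℂ] H) (α : FreeMonoid (Fin n)) : H →L[ℂ] H :=
  FreeMonoid.lift T α

/-- `Φ_{p,T}(X) = ∑ a_α T_α X T_α^*`. -/
def PosRegPoly.Phi (p : PosRegPoly n) (T : Fin n → H →L[ℂ] H) (X : H →L[ℂ] H) : H →L[ℂ] H :=
  ∑ α ∈ p.toPoly.coeff.support,
    (p.a α : ℂ) • (word T α ∘L X ∘L ContinuousLinearMap.adjoint (word T α))

variable (H) in
/-- The noncommutative domain `D_p(H) = {T ∈ B(H)ⁿ : ‖∑ a_α T_α T_α^*‖ ≤ 1}`. -/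
def PosRegPoly.domain (p : PosRegPoly n) : Set (Fin n → H →L[ℂ] H) :=
  {T | ‖∑ α ∈ p.toPoly.coeff.support,
    (p.a α : ℂ) • (word T α ∘L ContinuousLinearMap.adjoint (word T α))‖ ≤ 1}

/-- The defect operator `Δ_{p,T} = (I - Φ_{p,T}(I))^{1/2}`. -/
def PosRegPoly.defect (p : PosRegPoly n) (T : Fin n → H →L[ℂ] H) : H →L[ℂ] H :=
  CFC.sqrt (1 - p.Phi T 1)

/-- The defect space, i.e. the closure of `Δ_{p,T} H`. -/
def PosRegPoly.defectSpace (p : PosRegPoly n) (T : Fin n → H →L[ℂ] H) : Submodule ℂ H :=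
  (LinearMap.range (p.defect T).toLinearMap).topologicalClosure

/-- `Δ_{p,T}` as an operator from `H` to the defect space. -/
def PosRegPoly.defectMap (p : PosRegPoly n) (T : Fin n → H →L[ℂ] H) : H →L[ℂ] p.defectSpace T :=
  (p.defect T).codRestrict (p.defectSpace T) fun h =>
    Submodule.le_topologicalClosure _ ⟨h, rfl⟩

end Domain

/-! ### Full Fock space, weighted left creation operators, Hilbert tensor products -/

/-- The full Fock space `F²(H_n)`, with its orthonormal basis `e_α` indexed by words. -/
abbrev Fock (n : ℕ) : Type := lp (fun _ : FreeMonoid (Fin n) => ℂ) 2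

/-- The basis vector `e_α = e_{i_1} ⊗ ⋯ ⊗ e_{i_k}` of the full Fock space. -/
def fockBasis (α : FreeMonoid (Fin n)) : Fock n := by
  classical exact lp.single 2 α (1 : ℂ)

/-- The Hilbert space tensor product. -/
abbrev HTensor (E F : Type*) [NormedAddCommGroup E] [InnerProductSpace ℂ E]
    [NormedAddCommGroup F] [InnerProductSpace ℂ F] : Type _ :=
  UniformSpace.Completion (E ⊗[ℂ] F)

section HTensor

variable {E F : Type*} [NormedAddCommGroup E] [InnerProductSpace ℂ E]
  [NormedAddCommGroup F] [InnerProductSpace ℂ F]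

/-- The elementary tensor `x ⊗ y` in the Hilbert space tensor product. -/
def htmul (x : E) (y : F) : HTensor E F := ((x ⊗ₜ[ℂ] y : E ⊗[ℂ] F) : HTensor E F)

variable (F) in
/-- The ampliation `A ⊗ I_F`: the bounded operator with `(A ⊗ I)(x ⊗ y) = A x ⊗ y`. -/
def ampliation (A : E →L[ℂ] E) : HTensor E F →L[ℂ] HTensor E F :=
  (UniformSpace.Completion.toComplL ∘L A.rTensor F).extend
    (UniformSpace.Completion.toComplL (𝕜 := ℂ) (E := E ⊗[ℂ] F))

lemma ampliation_htmul (A : E →L[ℂ] E) (x : E) (y : F) :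
    ampliation F A (htmul x y) = htmul (A x) y := by
  refine (ContinuousLinearMap.extend_eq _ ?_ ?_ _).trans ?_
  · exact UniformSpace.Completion.denseRange_coe
  · exact UniformSpace.Completion.isUniformInducing_coe _
  · rfl

lemma inner_htmul (x x' : E) (y y' : F) :
    inner ℂ (htmul x y) (htmul x' y') = inner ℂ x x' * inner ℂ y y' := by
  simp [htmul]

lemma norm_htmul (x : E) (y : F) : ‖htmul x y‖ = ‖x‖ * ‖y‖ := by
  rw [htmul, UniformSpace.Completion.norm_coe, TensorProduct.norm_tmul]

lemma htmul_add (x : E) (y z : F) : htmul x (y + z) = htmul x y + htmul x z := by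
  rw [htmul, TensorProduct.tmul_add, UniformSpace.Completion.coe_add]
  rfl

lemma htmul_smul (c : ℂ) (x : E) (y : F) : htmul x (c • y) = c • htmul x y := by
  rw [htmul, TensorProduct.tmul_smul, UniformSpace.Completion.coe_smul]
  rfl

end HTensor

lemma norm_sum_sq_of_orthogonal {ι E : Type*} [NormedAddCommGroup E]
    [InnerProductSpace ℂ E] {v : ι → E}
    (hv : Pairwise fun i j => inner ℂ (v i) (v j) = 0) (s : Finset ι) :
    ‖∑ i ∈ s, v i‖ ^ 2 = ∑ i ∈ s, ‖v i‖ ^ 2 := by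
  classical
  induction s using Finset.induction_on with
  | empty => simp
  | insert i s hi ih =>
    rw [Finset.sum_insert hi, Finset.sum_insert hi, ← ih, sq, sq, sq]
    refine norm_add_sq_eq_norm_sq_add_norm_sq_of_inner_eq_zero (𝕜 := ℂ) _ _ ?_
    rw [inner_sum]
    refine Finset.sum_eq_zero fun j hj => hv ?_
    rintro rfl
    exact hi hj

section Series

variable {ι E G : Type*} [NormedAddCommGroup E] [InnerProductSpace ℂ E] [CompleteSpace E]
  [NormedAddCommGroup G] [InnerProductSpace ℂ G]

lemma summable_of_orthogonal {v : ι → E} (hv : Pairwise fun i j => inner ℂ (v i) (v j) = 0)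
    {C : ℝ} (hC : ∀ s : Finset ι, ∑ i ∈ s, ‖v i‖ ^ 2 ≤ C) : Summable v := by
  have hO : OrthogonalFamily ℂ (fun i => (Submodule.span ℂ {v i} : Submodule ℂ E))
      fun i => (Submodule.span ℂ {v i}).subtypeₗᵢ := by
    intro i j hij x y
    obtain ⟨c, hc⟩ := Submodule.mem_span_singleton.1 x.2
    obtain ⟨d, hd⟩ := Submodule.mem_span_singleton.1 y.2
    change inner ℂ (x : E) (y : E) = 0
    rw [← hc, ← hd, inner_smul_left, inner_smul_right, hv hij]
    simp
  have h2 : Summable fun i => ‖v i‖ ^ 2 :=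
    summable_of_sum_le (fun i => sq_nonneg _) hC
  exact (hO.summable_iff_norm_sq_summable
    (fun i => ⟨v i, Submodule.mem_span_singleton_self _⟩)).2 h2

/-- The bounded operator `g ↦ ∑_i c_i g` given by a series with pairwise orthogonal terms such that
`∑_i ‖c_i g‖² ≤ C² ‖g‖²`. -/
def orthSeries (c : ι → G →ₗ[ℂ] E) (C : ℝ) (hC : 0 ≤ C)
    (horth : ∀ g, Pairwise fun i j => inner ℂ (c i g) (c j g) = 0)
    (hbd : ∀ g, ∀ s : Finset ι, ∑ i ∈ s, ‖c i g‖ ^ 2 ≤ (C * ‖g‖) ^ 2) : G →L[ℂ] E :=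
  LinearMap.mkContinuous
    { toFun := fun g => ∑' i, c i g
      map_add' := fun x y => by
        simp only [map_add]
        exact (summable_of_orthogonal (horth x) (hbd x)).tsum_add
          (summable_of_orthogonal (horth y) (hbd y))
      map_smul' := fun r x => by
        simp only [map_smul, RingHom.id_apply]
        exact (summable_of_orthogonal (horth x) (hbd x)).tsum_const_smul r } C
    (fun g => by
      refine le_of_tendsto ((summable_of_orthogonal (horth g) (hbd g)).hasSum.norm)
        (Eventually.of_forall fun s => ?_)
      refine le_of_sq_le_sq ?_ (mul_nonneg hC (norm_nonneg _))
      rw [norm_sum_sq_of_orthogonal (horth g)]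
      exact hbd g s)

lemma hasSum_orthSeries (c : ι → G →ₗ[ℂ] E) (C : ℝ) (hC : 0 ≤ C)
    (horth : ∀ g, Pairwise fun i j => inner ℂ (c i g) (c j g) = 0)
    (hbd : ∀ g, ∀ s : Finset ι, ∑ i ∈ s, ‖c i g‖ ^ 2 ≤ (C * ‖g‖) ^ 2) (g : G) :
    HasSum (fun i => c i g) (orthSeries c C hC horth hbd g) :=
  (summable_of_orthogonal (horth g) (hbd g)).hasSum

end Series

lemma norm_fockBasis (α : FreeMonoid (Fin n)) : ‖fockBasis α‖ = 1 := by
  classical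
  simp [fockBasis, lp.norm_single]

lemma inner_fockBasis {α β : FreeMonoid (Fin n)} (h : α ≠ β) :
    inner ℂ (fockBasis α) (fockBasis β) = 0 := by
  classical
  simp [fockBasis, lp.inner_single_left, lp.single_apply, h]

lemma sum_norm_sq_fock_le (f : Fock n) (s : Finset (FreeMonoid (Fin n))) :
    ∑ α ∈ s, ‖f α‖ ^ 2 ≤ ‖f‖ ^ 2 := by
  have := lp.sum_rpow_le_norm_rpow (p := 2) (by norm_num) f s
  simpa using this

/-- The weighted left creation operator `W_i` associated with `p`:
`W_i f = ∑_α √(b_α / b_{g_i α}) f_α e_{g_i α}`, so that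
`W_i e_α = √(b_α / b_{g_i α}) e_{g_i α}`. -/
def PosRegPoly.W (p : PosRegPoly n) (i : Fin n) : Fock n →L[ℂ] Fock n :=
  orthSeries
    (fun α =>
      { toFun := fun f => ((√(p.b α / p.b (FreeMonoid.of i * α)) : ℂ) * f α) •
          fockBasis (FreeMonoid.of i * α)
        map_add' := fun f g => by simp [mul_add, add_smul]
        map_smul' := fun c f => by simp [smul_smul]; ring_nf })
    (√(1 / p.a (FreeMonoid.of i))) (Real.sqrt_nonneg _)
    (fun f α β h => by
      have : FreeMonoid.of i * α ≠ FreeMonoid.of i * β := fun h' => h (mul_left_cancel h')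
      simp [inner_fockBasis this])
    (fun f s => by
      have ha : 0 < p.a (FreeMonoid.of i) := p.coeff_of_pos i
      rw [mul_pow, Real.sq_sqrt (by positivity)]
      refine le_trans ?_ (mul_le_mul_of_nonneg_left (sum_norm_sq_fock_le f s) (by positivity))
      rw [Finset.mul_sum]
      refine Finset.sum_le_sum fun α _ => ?_
      have hb := p.b_pos α
      have hb' := p.b_pos (FreeMonoid.of i * α)
      have hle : p.b α / p.b (FreeMonoid.of i * α) ≤ 1 / p.a (FreeMonoid.of i) := by
        rw [div_le_div_iff₀ hb' ha, one_mul, mul_comm]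
        exact p.a_mul_b_le i α
      simp only [LinearMap.coe_mk, AddHom.coe_mk, norm_smul, norm_mul, norm_fockBasis, mul_one,
        Complex.norm_real, mul_pow, Real.norm_eq_abs, sq_abs]
      rw [Real.sq_sqrt (by positivity)]
      gcongr)

lemma PosRegPoly.W_fockBasis (p : PosRegPoly n) (i : Fin n) (α : FreeMonoid (Fin n)) :
    p.W i (fockBasis α) =
      (√(p.b α / p.b (FreeMonoid.of i * α)) : ℂ) • fockBasis (FreeMonoid.of i * α) := by
  classical
  have h1 : HasSum _ (p.W i (fockBasis α)) := hasSum_orthSeries _ _ _ _ _ (fockBasis α)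
  have h2 := hasSum_single (L := SummationFilter.unconditional _)
    (f := fun β => (((√(p.b β / p.b (FreeMonoid.of i * β)) : ℝ) : ℂ) * fockBasis α β) •
      fockBasis (FreeMonoid.of i * β)) α (fun β hβ => by
        simp [fockBasis, lp.single_apply, hβ])
  refine (h1.unique h2).trans ?_
  simp [fockBasis, lp.single_apply]

/-! ### The Poisson kernel -/

section Poisson

variable {H : Type*} [NormedAddCommGroup H] [InnerProductSpace ℂ H] [CompleteSpace H]

/-- The action `α ↦ (X ↦ T_α X T_α^*)` of words on `B(H)`. -/
def conjHom (T : Fin n → H →L[ℂ] H) : FreeMonoid (Fin n) →* Module.End ℝ (H →L[ℂ] H) where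
  toFun α :=
    { toFun := fun X => word T α * X * star (word T α)
      map_add' := fun X Y => by rw [mul_add, add_mul]
      map_smul' := fun c X => by
        rw [mul_smul_comm, smul_mul_assoc, RingHom.id_apply] }
  map_one' := by ext1 X; simp [word]
  map_mul' α β := by
    ext1 X
    simp [word, mul_assoc]

/-- `X ↦ ∑ q_α T_α X T_α^*` for an arbitrary polynomial `q`. -/
def polyMap (T : Fin n → H →L[ℂ] H) :
    MonoidAlgebra ℝ (FreeMonoid (Fin n)) →ₐ[ℝ] Module.End ℝ (H →L[ℂ] H) :=
  MonoidAlgebra.lift ℝ _ _ (conjHom T)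

lemma polyMap_apply (T : Fin n → H →L[ℂ] H) (q : MonoidAlgebra ℝ (FreeMonoid (Fin n)))
    (X : H →L[ℂ] H) :
    polyMap T q X = ∑ α ∈ q.coeff.support,
      ((q.coeff α : ℝ) : ℂ) • (word T α ∘L X ∘L ContinuousLinearMap.adjoint (word T α)) := by
  rw [polyMap, MonoidAlgebra.lift_apply, Finsupp.sum, LinearMap.sum_apply]
  refine Finset.sum_congr rfl fun α _ => ?_
  rw [LinearMap.smul_apply]
  ext h
  simp [conjHom, ContinuousLinearMap.star_eq_adjoint]

lemma PosRegPoly.Phi_eq_polyMap (p : PosRegPoly n) (T : Fin n → H →L[ℂ] H) (X : H →L[ℂ] H) :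
    p.Phi T X = polyMap T p.toPoly X := (polyMap_apply T p.toPoly X).symm

lemma re_inner_polyMap (T : Fin n → H →L[ℂ] H) (q : MonoidAlgebra ℝ (FreeMonoid (Fin n)))
    (X : H →L[ℂ] H) (h : H) :
    (inner ℂ h (polyMap T q X h)).re = ∑ α ∈ q.coeff.support, q.coeff α *
      (inner ℂ (ContinuousLinearMap.adjoint (word T α) h)
        (X (ContinuousLinearMap.adjoint (word T α) h))).re := by
  rw [polyMap_apply, _root_.sum_apply, inner_sum, Complex.re_sum]
  refine Finset.sum_congr rfl fun α _ => ?_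
  rw [_root_.smul_apply, inner_smul_right, Complex.re_ofReal_mul,
    ContinuousLinearMap.comp_apply, ContinuousLinearMap.comp_apply,
    ContinuousLinearMap.adjoint_inner_left]

lemma PosRegPoly.Phi_one_nonneg (p : PosRegPoly n) (T : Fin n → H →L[ℂ] H) :
    0 ≤ p.Phi T 1 := by
  refine Finset.sum_nonneg fun α _ => ?_
  rw [ContinuousLinearMap.nonneg_iff_isPositive]
  refine ContinuousLinearMap.IsPositive.smul_of_nonneg
    (ContinuousLinearMap.isPositive_one.conj_adjoint _) ?_
  exact_mod_cast p.coeff_nonneg α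

lemma PosRegPoly.mem_domain_iff (p : PosRegPoly n) (T : Fin n → H →L[ℂ] H) :
    T ∈ p.domain H ↔ p.Phi T 1 ≤ 1 :=
  CStarAlgebra.norm_le_one_iff_of_nonneg (p.Phi T 1) (p.Phi_one_nonneg T)

lemma PosRegPoly.norm_defectMap_sq (p : PosRegPoly n) {T : Fin n → H →L[ℂ] H}
    (hT : T ∈ p.domain H) (h : H) :
    ‖p.defectMap T h‖ ^ 2 = (inner ℂ h ((1 - p.Phi T 1 : H →L[ℂ] H) h)).re := by
  have h0 : 0 ≤ 1 - p.Phi T 1 := sub_nonneg.2 ((p.mem_domain_iff T).1 hT)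
  have hs : star (p.defect T) = p.defect T :=
    (IsSelfAdjoint.of_nonneg (CFC.sqrt_nonneg (1 - p.Phi T 1))).star_eq
  have hm : p.defect T * p.defect T = 1 - p.Phi T 1 := CFC.sqrt_mul_sqrt_self _ h0
  have hn : ‖p.defectMap T h‖ = ‖p.defect T h‖ := rfl
  rw [hn, ← hm, _root_.mul_apply_eq_comp, ← ContinuousLinearMap.adjoint_inner_left,
    ← ContinuousLinearMap.star_eq_adjoint, hs]
  exact (inner_self_eq_norm_sq (𝕜 := ℂ) (p.defect T h)).symm

lemma PosRegPoly.sum_b_le (p : PosRegPoly n) {T : Fin n → H →L[ℂ] H} (hT : T ∈ p.domain H)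
    (h : H) (s : Finset (FreeMonoid (Fin n))) :
    ∑ α ∈ s, p.b α * ‖p.defectMap T (ContinuousLinearMap.adjoint (word T α) h)‖ ^ 2 ≤
      ‖h‖ ^ 2 := by
  classical
  set q : FreeMonoid (Fin n) → ℝ := fun α =>
    ‖p.defectMap T (ContinuousLinearMap.adjoint (word T α) h)‖ ^ 2 with hq
  have hq0 : ∀ α, 0 ≤ q α := fun α => sq_nonneg _
  set N := s.sup FreeMonoid.length + 1 with hN
  set u : ℕ → ℝ := fun j => (inner ℂ h (polyMap T (p.toPoly ^ j) 1 h)).re with hu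
  have hstep : ∀ j, ∑ α ∈ (p.toPoly ^ j).coeff.support, (p.toPoly ^ j).coeff α * q α =
      u j - u (j + 1) := by
    intro j
    have h1 : ∀ α, q α = _ := fun α => p.norm_defectMap_sq hT _
    simp only [h1]
    rw [← re_inner_polyMap, map_sub, _root_.sub_apply, inner_sub_right,
      Complex.sub_re, p.Phi_eq_polyMap, ← Module.End.mul_apply, ← map_mul, ← pow_succ]
  calc ∑ α ∈ s, p.b α * q α
      ≤ ∑ α ∈ s, ∑ j ∈ Finset.range N, (p.toPoly ^ j).coeff α * q α := by
        refine Finset.sum_le_sum fun α hα => ?_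
        rw [PosRegPoly.b, Finset.sum_mul]
        refine Finset.sum_le_sum_of_subset_of_nonneg ?_
          fun j _ _ => mul_nonneg (p.coeff_pow_nonneg j α) (hq0 α)
        have : α.length ≤ s.sup FreeMonoid.length := Finset.le_sup hα
        exact Finset.range_subset_range.2 (by omega)
    _ = ∑ j ∈ Finset.range N, ∑ α ∈ s, (p.toPoly ^ j).coeff α * q α := Finset.sum_comm
    _ ≤ ∑ j ∈ Finset.range N, (u j - u (j + 1)) := by
        refine Finset.sum_le_sum fun j _ => ?_
        rw [← hstep j]
        refine le_trans (Finset.sum_le_sum_of_subset_of_nonneg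
          (Finset.subset_union_left (s₂ := (p.toPoly ^ j).coeff.support))
          fun α _ _ => mul_nonneg (p.coeff_pow_nonneg j α) (hq0 α)) (le_of_eq ?_)
        refine (Finset.sum_subset Finset.subset_union_right fun α _ hα => ?_).symm
        rw [Finsupp.notMem_support_iff.1 hα, zero_mul]
    _ = u 0 - u N := Finset.sum_range_sub' u N
    _ ≤ ‖h‖ ^ 2 := by
        have h0 : u 0 = ‖h‖ ^ 2 := by
          simp only [hu, pow_zero, map_one, Module.End.one_apply, _root_.one_apply_eq_self]
          exact inner_self_eq_norm_sq (𝕜 := ℂ) h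
        have hNn : 0 ≤ u N := by
          simp only [hu]
          rw [re_inner_polyMap]
          refine Finset.sum_nonneg fun α _ => mul_nonneg (p.coeff_pow_nonneg N α) ?_
          exact inner_self_nonneg (𝕜 := ℂ)
        linarith

/-- The Poisson kernel `K_{p,T} : H → F²(H_n) ⊗ closure (Δ_{p,T} H)`,
`K_{p,T} h = ∑_α √b_α e_α ⊗ Δ_{p,T} T_α^* h`. -/
def PosRegPoly.poissonKernel (p : PosRegPoly n) (T : Fin n → H →L[ℂ] H) (hT : T ∈ p.domain H) :
    H →L[ℂ] HTensor (Fock n) (p.defectSpace T) :=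
  orthSeries
    (fun α =>
      { toFun := fun h => (√(p.b α) : ℂ) •
          htmul (fockBasis α) (p.defectMap T (ContinuousLinearMap.adjoint (word T α) h))
        map_add' := fun h k => by rw [map_add, map_add, htmul_add, smul_add]
        map_smul' := fun c h => by
          rw [map_smul, map_smul, htmul_smul, smul_comm, RingHom.id_apply] })
    1 zero_le_one
    (fun h α β hne => by
      simp [inner_htmul, inner_fockBasis hne])
    (fun h s => by
      rw [one_mul]
      refine le_trans (le_of_eq ?_) (p.sum_b_le hT h s)
      refine Finset.sum_congr rfl fun α _ => ?_
      simp only [LinearMap.coe_mk, AddHom.coe_mk, norm_smul, norm_htmul, norm_fockBasis, one_mul,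
        Complex.norm_real, mul_pow, Real.norm_eq_abs, sq_abs]
      rw [Real.sq_sqrt (p.b_nonneg α)])

lemma PosRegPoly.hasSum_poissonKernel (p : PosRegPoly n) (T : Fin n → H →L[ℂ] H)
    (hT : T ∈ p.domain H) (h : H) :
    HasSum (fun α => (√(p.b α) : ℂ) •
        htmul (fockBasis α) (p.defectMap T (ContinuousLinearMap.adjoint (word T α) h)))
      (p.poissonKernel T hT h) :=
  hasSum_orthSeries _ _ _ _ _ h

end Poisson

/-! ### Trace and curvature -/

lemma tsum_norm_sq_hilbertBasis {H : Type*} [NormedAddCommGroup H] [InnerProductSpace ℂ H]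
    {ι : Type*} (b : HilbertBasis ι ℂ H) (x : H) :
    ∑' i, ENNReal.ofReal (‖inner ℂ (b i) x‖ ^ 2) = ENNReal.ofReal (‖x‖ ^ 2) := by
  have h := (b.hasSum_inner_mul_inner x x).mapL Complex.reCLM
  have h' : HasSum (fun i => ‖inner ℂ (b i) x‖ ^ 2) (‖x‖ ^ 2) := by
    convert! h using 1
    · ext i
      rw [Complex.reCLM_apply]
      have := inner_mul_symm_re_eq_norm (𝕜 := ℂ) x (b i)
      rw [norm_mul, norm_inner_symm x, ← sq] at this
      exact this.symm
    · exact (inner_self_eq_norm_sq (𝕜 := ℂ) x).symm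
  rw [← ENNReal.ofReal_tsum_of_nonneg (fun i => sq_nonneg _) h'.summable, h'.tsum_eq]

section Curvature

variable {H : Type*} [NormedAddCommGroup H] [InnerProductSpace ℂ H] [CompleteSpace H]

/-- The trace, with values in `[0, ∞]`, of a positive operator: `∑_i ⟨A e_i, e_i⟩` for an
orthonormal basis `(e_i)` of `H` (see `trace_eq_tsum` for the independence of the basis). -/
def trace (A : H →L[ℂ] H) : ℝ≥0∞ :=
  ∑' i, ENNReal.ofReal (inner ℂ ((exists_hilbertBasis ℂ H).choose_spec.choose i)
    (A ((exists_hilbertBasis ℂ H).choose_spec.choose i))).re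

lemma trace_eq_tsum {A : H →L[ℂ] H} (hA : A.IsPositive) {ι : Type*} (b : HilbertBasis ι ℂ H) :
    trace A = ∑' i, ENNReal.ofReal (inner ℂ (b i) (A (b i))).re := by
  have h0 : 0 ≤ A := (ContinuousLinearMap.nonneg_iff_isPositive A).2 hA
  set S := CFC.sqrt A with hS
  have hs : ContinuousLinearMap.adjoint S = S :=
    (IsSelfAdjoint.of_nonneg (CFC.sqrt_nonneg A)).star_eq
  have hm : S * S = A := CFC.sqrt_mul_sqrt_self A h0
  have key : ∀ x, ENNReal.ofReal (inner ℂ x (A x)).re = ENNReal.ofReal (‖S x‖ ^ 2) := by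
    intro x
    congr 1
    rw [← hm, _root_.mul_apply_eq_comp, ← ContinuousLinearMap.adjoint_inner_left, hs]
    exact inner_self_eq_norm_sq (𝕜 := ℂ) (S x)
  unfold trace
  simp only [key]
  generalize (exists_hilbertBasis ℂ H).choose_spec.choose = e
  calc ∑' i, ENNReal.ofReal (‖S (e i)‖ ^ 2)
      = ∑' i, ∑' j, ENNReal.ofReal (‖inner ℂ (b j) (S (e i))‖ ^ 2) := by
        simp only [tsum_norm_sq_hilbertBasis]
    _ = ∑' j, ∑' i, ENNReal.ofReal (‖inner ℂ (b j) (S (e i))‖ ^ 2) := ENNReal.tsum_comm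
    _ = ∑' j, ∑' i, ENNReal.ofReal (‖inner ℂ (e i) (S (b j))‖ ^ 2) := by
        congr! 4 with j i
        rw [← ContinuousLinearMap.adjoint_inner_left, hs, norm_inner_symm]
    _ = ∑' j, ENNReal.ofReal (‖S (b j)‖ ^ 2) := by
        simp only [tsum_norm_sq_hilbertBasis]

/-- The operator `K_{p,T}^* [I - Φ_{p,W}^{k+1}(I) ⊗ I] K_{p,T}`. -/
def PosRegPoly.curvOp (p : PosRegPoly n) (T : Fin n → H →L[ℂ] H) (hT : T ∈ p.domain H) (k : ℕ) :
    H →L[ℂ] H :=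
  ContinuousLinearMap.adjoint (p.poissonKernel T hT) ∘L
    (1 - ampliation (p.defectSpace T) ((p.Phi p.W)^[k + 1] 1)) ∘L p.poissonKernel T hT

/-- The quotients whose limit is the curvature. -/
def PosRegPoly.curvSeq (p : PosRegPoly n) (T : Fin n → H →L[ℂ] H) (hT : T ∈ p.domain H) (k : ℕ) :
    ℝ≥0∞ :=
  trace (p.curvOp T hT k) / ENNReal.ofReal (∑ j ∈ Finset.range (k + 1), p.gamma ^ j)

/-- The curvature `curv_p(T) ∈ [0, ∞]`. -/
def PosRegPoly.curv (p : PosRegPoly n) (T : Fin n → H →L[ℂ] H) (hT : T ∈ p.domain H) : ℝ≥0∞ :=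
  limUnder atTop (p.curvSeq T hT)

end Curvature

end NCDomain

end

open NCDomain

/-!
Write `Φ = Φ_{p,T}`, `Δ² = I - Φ(I)` and `K = K_{p,T}`. The Poisson kernel intertwines
`K^* (W_α ⊗ I) = T_α K^*`, so compression by `K` carries `Φ_{p,W} ⊗ id` to `Φ`
(`PosRegPoly.compression_Phi`), and the operator in the statement is `K^* K - Φ^{k+1}(K^* K)`.
The coefficients satisfy `b_β = ∑_{β = γ δ} a_γ b_δ` for `β ≠ g_0`
(`PosRegPoly.sum_a_mul_bShift`); sorting the series for `‖K h‖²` by the first factor of each word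
therefore gives `K^* K - Φ(K^* K) = Δ²` (`PosRegPoly.adjoint_comp_poissonKernel_sub_Phi`), and by
telescoping the operator equals `∑_{j ≤ k} Φ^j(Δ²)` (`PosRegPoly.curvOp_eq_sum`). This is positive,
and no limit of the powers `Φ^k(I)` is needed.

The same recursion for `b` yields `‖T_α‖² ≤ 1 / b_α` (`PosRegPoly.norm_word_sq_le`), whence
`trace Φ(X) ≤ ∑ a_α ‖T_α‖² trace X ≤ γ trace X` for `X ≥ 0` (`PosRegPoly.trace_Phi_le`). So the
numbers `t_j = trace Φ^j(Δ²) ∈ [0, ∞]` satisfy `t_{j+1} ≤ γ t_j`, and the quotients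
`(∑_{j ≤ k} t_j) / (∑_{j ≤ k} γ^j)` decrease in `k` (`antitone_sum_div_geom_sum`). Hence the limit
exists and is at most the first quotient, `t_0 = trace (I - Φ(I))`; if `t_0 = ∞`, then every
quotient is `∞`.
-/

noncomputable section

namespace NCDomain

variable {n : ℕ}

/-! ### The recursion for the coefficients `b_α` -/

namespace PosRegPoly

variable (p : PosRegPoly n)

/-- The coefficient of `X_β` in `X_γ (1 - p)⁻¹`: it is `b_δ` if `β = γ δ`, and `0` if `γ` is not a
prefix of `β`. -/
def bShift (γ β : FreeMonoid (Fin n)) : ℝ :=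
  Function.extend (γ * ·) p.b (0 : FreeMonoid (Fin n) → ℝ) β

lemma bShift_mul (γ δ : FreeMonoid (Fin n)) : p.bShift γ (γ * δ) = p.b δ :=
  (mul_right_injective γ).extend_apply p.b _ δ

lemma bShift_eq_zero {γ β : FreeMonoid (Fin n)} (h : ∀ δ, γ * δ ≠ β) : p.bShift γ β = 0 :=
  Function.extend_apply' p.b _ β fun ⟨δ, hδ⟩ => h δ hδ

lemma ne_one_of_mem_support {γ : FreeMonoid (Fin n)} (hγ : γ ∈ p.toPoly.coeff.support) :
    γ ≠ 1 := by
  rintro rfl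
  exact Finsupp.mem_support_iff.1 hγ p.coeff_one

lemma length_lt_of_mem_support {γ : FreeMonoid (Fin n)} (hγ : γ ∈ p.toPoly.coeff.support)
    (δ : FreeMonoid (Fin n)) : δ.length < (γ * δ).length := by
  have h : γ.length ≠ 0 := fun h => p.ne_one_of_mem_support hγ (FreeMonoid.length_eq_zero.1 h)
  rw [FreeMonoid.length_mul]
  omega

/-- Left multiplication by `p`, coefficientwise. -/
lemma coeff_toPoly_mul (y : MonoidAlgebra ℝ (FreeMonoid (Fin n))) (β : FreeMonoid (Fin n)) :
    (p.toPoly * y).coeff β =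
      ∑ γ ∈ p.toPoly.coeff.support,
        p.a γ * Function.extend (γ * ·) (⇑y.coeff) (0 : FreeMonoid (Fin n) → ℝ) β := by
  classical
  rw [MonoidAlgebra.coeff_mul]
  refine Finset.sum_congr rfl fun γ _ => ?_
  by_cases h : ∃ δ, γ * δ = β
  · obtain ⟨δ, rfl⟩ := h
    rw [(mul_right_injective γ).extend_apply]
    simp only [mul_right_inj, Finsupp.sum_ite_eq']
    by_cases hδ : y.coeff δ = 0
    · simp [hδ]
    · simp [hδ, a]
  · rw [Function.extend_apply' _ _ _ h]
    push Not at h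
    simp [h, Finsupp.sum]

lemma coeff_pow_eq_zero {j : ℕ} {α : FreeMonoid (Fin n)} (h : α.length < j) :
    (p.toPoly ^ j).coeff α = 0 := by
  induction j generalizing α with
  | zero => omega
  | succ j ih =>
    rw [pow_succ', coeff_toPoly_mul]
    refine Finset.sum_eq_zero fun γ hγ => ?_
    by_cases hd : ∃ δ, γ * δ = α
    · obtain ⟨δ, rfl⟩ := hd
      have := p.length_lt_of_mem_support hγ δ
      rw [(mul_right_injective γ).extend_apply, ih (by omega), mul_zero]
    · rw [Function.extend_apply' _ _ _ hd, Pi.zero_apply, mul_zero]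

lemma b_eq_sum_range {α : FreeMonoid (Fin n)} {N : ℕ} (h : α.length < N) :
    p.b α = ∑ j ∈ Finset.range N, (p.toPoly ^ j).coeff α := by
  refine Finset.sum_subset (Finset.range_subset_range.2 h) fun j _ hj => ?_
  refine p.coeff_pow_eq_zero ?_
  simpa using hj

lemma bShift_one {γ : FreeMonoid (Fin n)} (hγ : γ ∈ p.toPoly.coeff.support) :
    p.bShift γ 1 = 0 := by
  refine p.bShift_eq_zero fun δ hδ => ?_
  have := p.length_lt_of_mem_support hγ δ
  rw [hδ] at this
  simp at this

/-- The identity `(1 - p)⁻¹ = 1 + p (1 - p)⁻¹`, coefficientwise. -/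
lemma sum_a_mul_bShift {β : FreeMonoid (Fin n)} (hβ : β ≠ 1) :
    ∑ γ ∈ p.toPoly.coeff.support, p.a γ * p.bShift γ β = p.b β := by
  have h0 : (p.toPoly ^ 0).coeff β = 0 := by
    rw [pow_zero, MonoidAlgebra.one_def, MonoidAlgebra.coeff_single,
      Finsupp.single_eq_of_ne hβ]
  rw [p.b_eq_sum_range (Nat.lt_succ_self β.length),
    Finset.sum_range_succ', h0, add_zero]
  simp only [pow_succ', coeff_toPoly_mul]
  rw [Finset.sum_comm]
  refine Finset.sum_congr rfl fun γ hγ => ?_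
  rw [← Finset.mul_sum]
  congr 1
  by_cases hd : ∃ δ, γ * δ = β
  · obtain ⟨δ, rfl⟩ := hd
    have := p.length_lt_of_mem_support hγ δ
    simp only [bShift_mul, (mul_right_injective γ).extend_apply]
    exact p.b_eq_sum_range (by omega)
  · simp only [bShift, Function.extend_apply' _ _ _ hd, Pi.zero_apply, Finset.sum_const_zero]

lemma gamma_nonneg : 0 ≤ p.gamma :=
  Finset.sum_nonneg fun α _ => div_nonneg (p.coeff_nonneg α) (p.b_nonneg α)

end PosRegPoly

/-! ### Norms of monomials on the noncommutative domain -/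

section Domain

variable {H : Type*} [NormedAddCommGroup H] [InnerProductSpace ℂ H] [CompleteSpace H]

lemma adjoint_word_mul (T : Fin n → H →L[ℂ] H) (α β : FreeMonoid (Fin n)) (h : H) :
    ContinuousLinearMap.adjoint (word T (α * β)) h =
      ContinuousLinearMap.adjoint (word T β) (ContinuousLinearMap.adjoint (word T α) h) := by
  simp only [word, map_mul, ← ContinuousLinearMap.star_eq_adjoint, star_mul,
    _root_.mul_apply_eq_comp]

variable (p : PosRegPoly n) {T : Fin n → H →L[ℂ] H}

lemma PosRegPoly.sum_a_mul_norm_sq_le (hT : T ∈ p.domain H) (h : H) :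
    ∑ γ ∈ p.toPoly.coeff.support, p.a γ * ‖ContinuousLinearMap.adjoint (word T γ) h‖ ^ 2 ≤
      ‖h‖ ^ 2 := by
  have h1 := (ContinuousLinearMap.nonneg_iff_isPositive _).1
    (sub_nonneg.2 ((p.mem_domain_iff T).1 hT))
  have h2 := h1.re_inner_nonneg_right h
  rw [p.Phi_eq_polyMap, _root_.sub_apply, inner_sub_right, map_sub, sub_nonneg] at h2
  refine le_trans (le_of_eq ?_) (h2.trans_eq (inner_self_eq_norm_sq (𝕜 := ℂ) h))
  refine Eq.trans ?_ (re_inner_polyMap T p.toPoly 1 h).symm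
  refine Finset.sum_congr rfl fun γ _ => ?_
  congr 1
  exact (inner_self_eq_norm_sq (𝕜 := ℂ) _).symm

/-- The von Neumann inequality `‖T_α‖² ≤ 1 / b_α = ‖W_α‖²` for monomials. Since
`b_α = ∑_{α = γ δ} a_γ b_δ`, induction on the length of `α` bounds `b_α ‖T_α^* h‖²` by
`∑ a_γ ‖T_γ^* h‖² = ⟨Φ_{p,T}(I) h, h⟩ ≤ ‖h‖²`. -/
lemma PosRegPoly.b_mul_norm_sq_le (hT : T ∈ p.domain H) (α : FreeMonoid (Fin n)) (h : H) :
    p.b α * ‖ContinuousLinearMap.adjoint (word T α) h‖ ^ 2 ≤ ‖h‖ ^ 2 := by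
  induction hl : α.length using Nat.strong_induction_on generalizing α h with
  | _ l ih =>
  by_cases h1 : α = 1
  · subst h1
    simp [p.b_one, word, ← ContinuousLinearMap.star_eq_adjoint]
  · rw [← p.sum_a_mul_bShift h1, Finset.sum_mul]
    refine le_trans (Finset.sum_le_sum fun γ hγ => ?_) (p.sum_a_mul_norm_sq_le hT h)
    rw [mul_assoc]
    refine mul_le_mul_of_nonneg_left ?_ (p.coeff_nonneg γ)
    by_cases hd : ∃ δ, γ * δ = α
    · obtain ⟨δ, rfl⟩ := hd
      rw [p.bShift_mul, adjoint_word_mul]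
      exact ih _ (hl ▸ p.length_lt_of_mem_support hγ δ) _ _ rfl
    · rw [p.bShift_eq_zero (by simpa using hd), zero_mul]
      positivity

lemma PosRegPoly.norm_word_sq_le (hT : T ∈ p.domain H) (α : FreeMonoid (Fin n)) :
    ‖word T α‖ ^ 2 ≤ 1 / p.b α := by
  have hb := p.b_pos α
  rw [← LinearIsometryEquiv.norm_map ContinuousLinearMap.adjoint (word T α),
    ← Real.le_sqrt (norm_nonneg _) (by positivity)]
  refine ContinuousLinearMap.opNorm_le_bound _ (Real.sqrt_nonneg _) fun h => ?_
  refine le_of_sq_le_sq ?_ (by positivity)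
  rw [mul_pow, Real.sq_sqrt (by positivity), div_mul_eq_mul_div, one_mul, le_div_iff₀ hb, mul_comm]
  exact p.b_mul_norm_sq_le hT α h

end Domain

/-! ### The trace -/

section Trace

variable {H : Type*} [NormedAddCommGroup H] [InnerProductSpace ℂ H] [CompleteSpace H]

lemma trace_zero : trace (0 : H →L[ℂ] H) = 0 := by simp [trace]

lemma trace_add {A B : H →L[ℂ] H} (hA : 0 ≤ A) (hB : 0 ≤ B) :
    trace (A + B) = trace A + trace B := by
  have h : ∀ {C : H →L[ℂ] H}, 0 ≤ C → ∀ x, 0 ≤ (inner ℂ x (C x)).re := fun hC x =>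
    ((ContinuousLinearMap.nonneg_iff_isPositive _).1 hC).re_inner_nonneg_right x
  unfold trace
  rw [← ENNReal.tsum_add]
  refine tsum_congr fun i => ?_
  rw [_root_.add_apply, inner_add_right, Complex.add_re,
    ENNReal.ofReal_add (h hA _) (h hB _)]

lemma trace_sum {ι : Type*} (s : Finset ι) {A : ι → H →L[ℂ] H} (hA : ∀ i ∈ s, 0 ≤ A i) :
    trace (∑ i ∈ s, A i) = ∑ i ∈ s, trace (A i) := by
  classical
  induction s using Finset.induction_on with
  | empty => simp [trace_zero]
  | insert i s hi ih =>
    rw [Finset.sum_insert hi, Finset.sum_insert hi, trace_add (hA i (Finset.mem_insert_self i s))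
      (Finset.sum_nonneg fun j hj => hA j (Finset.mem_insert_of_mem hj)),
      ih fun j hj => hA j (Finset.mem_insert_of_mem hj)]

lemma trace_smul {c : ℝ} (hc : 0 ≤ c) (A : H →L[ℂ] H) :
    trace ((c : ℂ) • A) = ENNReal.ofReal c * trace A := by
  unfold trace
  rw [← ENNReal.tsum_mul_left]
  refine tsum_congr fun i => ?_
  rw [_root_.smul_apply, inner_smul_right, Complex.re_ofReal_mul, ENNReal.ofReal_mul hc]

/-- The Hilbert–Schmidt norm of an operator and of its adjoint agree. -/
lemma tsum_norm_adjoint_sq {ι : Type*} (e : HilbertBasis ι ℂ H) (S : H →L[ℂ] H) :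
    ∑' i, ENNReal.ofReal (‖ContinuousLinearMap.adjoint S (e i)‖ ^ 2) =
      ∑' i, ENNReal.ofReal (‖S (e i)‖ ^ 2) := by
  calc ∑' i, ENNReal.ofReal (‖ContinuousLinearMap.adjoint S (e i)‖ ^ 2)
      = ∑' i, ∑' j, ENNReal.ofReal (‖inner ℂ (e j) (ContinuousLinearMap.adjoint S (e i))‖ ^ 2) := by
        simp only [tsum_norm_sq_hilbertBasis]
    _ = ∑' j, ∑' i, ENNReal.ofReal
          (‖inner ℂ (e j) (ContinuousLinearMap.adjoint S (e i))‖ ^ 2) := ENNReal.tsum_comm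
    _ = ∑' j, ∑' i, ENNReal.ofReal (‖inner ℂ (e i) (S (e j))‖ ^ 2) := by
        congr! 4 with j i
        rw [ContinuousLinearMap.adjoint_inner_right, norm_inner_symm]
    _ = ∑' j, ENNReal.ofReal (‖S (e j)‖ ^ 2) := by
        simp only [tsum_norm_sq_hilbertBasis]

/-- Writing `X = S²`, the trace of `A X A^*` is the Hilbert–Schmidt norm of `A S`. -/
lemma trace_conj_le {X : H →L[ℂ] H} (hX : 0 ≤ X) (A : H →L[ℂ] H) :
    trace (A ∘L X ∘L ContinuousLinearMap.adjoint A) ≤ ENNReal.ofReal (‖A‖ ^ 2) * trace X := by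
  set S := CFC.sqrt X
  have hs : ContinuousLinearMap.adjoint S = S :=
    (IsSelfAdjoint.of_nonneg (CFC.sqrt_nonneg X)).star_eq
  have hm : S * S = X := CFC.sqrt_mul_sqrt_self X hX
  have key : ∀ x, (inner ℂ x (X x)).re = ‖S x‖ ^ 2 := by
    intro x
    rw [← hm, _root_.mul_apply_eq_comp, ← ContinuousLinearMap.adjoint_inner_left, hs]
    exact inner_self_eq_norm_sq (𝕜 := ℂ) (S x)
  have key' : ∀ x, (inner ℂ x ((A ∘L X ∘L ContinuousLinearMap.adjoint A) x)).re =
      ‖ContinuousLinearMap.adjoint (A ∘L S) x‖ ^ 2 := by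
    intro x
    rw [ContinuousLinearMap.adjoint_comp, hs, ContinuousLinearMap.comp_apply,
      ContinuousLinearMap.comp_apply, ← ContinuousLinearMap.adjoint_inner_left, key,
      ContinuousLinearMap.comp_apply]
  unfold trace
  simp only [key, key']
  rw [tsum_norm_adjoint_sq, ← ENNReal.tsum_mul_left]
  refine ENNReal.tsum_le_tsum fun i => ?_
  rw [← ENNReal.ofReal_mul (by positivity), ← mul_pow]
  refine ENNReal.ofReal_le_ofReal ?_
  gcongr
  exact A.le_opNorm _

end Trace

/-! ### Ratios of partial sums -/

/-- If `t_{j+1} ≤ c t_j`, then the averages `(∑_{j ≤ k} t_j) / (∑_{j ≤ k} c^j)` decrease. -/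
lemma antitone_sum_div_geom_sum {t : ℕ → ℝ≥0∞} {c : ℝ≥0∞} (hc : c ≠ ∞)
    (ht : ∀ j, t (j + 1) ≤ c * t j) :
    Antitone fun k => (∑ j ∈ Finset.range (k + 1), t j) / ∑ j ∈ Finset.range (k + 1), c ^ j := by
  have hpow : ∀ j i, t (i + j) ≤ c ^ j * t i := by
    intro j i
    induction j with
    | zero => simp
    | succ j ih =>
      calc t (i + (j + 1)) ≤ c * t (i + j) := ht (i + j)
        _ ≤ c * (c ^ j * t i) := by gcongr
        _ = c ^ (j + 1) * t i := by rw [pow_succ', mul_assoc]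
  have h0 : ∀ k, ∑ j ∈ Finset.range (k + 1), c ^ j ≠ 0 := by
    intro k
    rw [Finset.sum_range_succ']
    simp
  have htop : ∀ k, ∑ j ∈ Finset.range (k + 1), c ^ j ≠ ∞ := fun k =>
    ENNReal.sum_ne_top.2 fun j _ => ENNReal.pow_ne_top hc
  refine antitone_nat_of_succ_le fun k => ?_
  rw [ENNReal.div_le_iff (h0 _) (htop _), mul_comm (_ / _), ← mul_div_assoc,
    ENNReal.le_div_iff_mul_le (Or.inl (h0 _)) (Or.inl (htop _)),
    Finset.sum_range_succ t, Finset.sum_range_succ _ (k + 1), add_mul, add_mul,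
    mul_comm (∑ j ∈ Finset.range (k + 1), c ^ j)]
  refine add_le_add_right ?_ _
  rw [Finset.mul_sum, Finset.mul_sum]
  refine Finset.sum_le_sum fun j hj => ?_
  obtain ⟨d, hd⟩ := Nat.exists_eq_add_of_le (Finset.mem_range_succ_iff.1 (Finset.mem_range.2
    ((Finset.mem_range.1 hj).trans (Nat.lt_succ_self _))))
  rw [hd]
  calc t (j + d) * c ^ j ≤ c ^ d * t j * c ^ j := by
        gcongr
        exact hpow d j
    _ = c ^ (j + d) * t j := by rw [pow_add]; ring

/-! ### Ampliations on Hilbert space tensor products -/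

section HTensor

variable {E F G : Type*} [NormedAddCommGroup E] [InnerProductSpace ℂ E]
  [NormedAddCommGroup F] [InnerProductSpace ℂ F] [NormedAddCommGroup G] [NormedSpace ℂ G]

/-- A bounded operator on a Hilbert space tensor product is determined by its values on elementary
tensors. -/
lemma htensor_ext {f g : HTensor E F →L[ℂ] G} (h : ∀ x y, f (htmul x y) = g (htmul x y)) :
    f = g := by
  ext z
  induction z using UniformSpace.Completion.induction_on with
  | hp => exact isClosed_eq f.continuous g.continuous
  | ih z =>
    induction z using TensorProduct.induction_on with
    | zero => rw [UniformSpace.Completion.coe_zero, map_zero, map_zero]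
    | tmul x y => exact h x y
    | add x y hx hy => rw [UniformSpace.Completion.coe_add, map_add, map_add, hx, hy]

variable (E) in
/-- The bounded operator `x ↦ x ⊗ y`. -/
def htmulRight (y : F) : E →L[ℂ] HTensor E F :=
  LinearMap.mkContinuous
    { toFun := fun x => htmul x y
      map_add' := fun x x' => by
        rw [htmul, TensorProduct.add_tmul, UniformSpace.Completion.coe_add]; rfl
      map_smul' := fun c x => by
        rw [htmul, ← TensorProduct.smul_tmul', UniformSpace.Completion.coe_smul]; rfl }
    ‖y‖ fun x => by
      simp only [LinearMap.coe_mk, AddHom.coe_mk, norm_htmul, mul_comm, le_refl]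

lemma htmulRight_apply (x : E) (y : F) : htmulRight E y x = htmul x y := rfl

lemma ampliation_one : ampliation F (1 : E →L[ℂ] E) = 1 :=
  htensor_ext fun x y => by simp [ampliation_htmul]

lemma ampliation_mul (A B : E →L[ℂ] E) :
    ampliation F (A * B) = ampliation F A * ampliation F B :=
  htensor_ext fun x y => by simp [ampliation_htmul]

lemma ampliation_sum {ι : Type*} (s : Finset ι) (A : ι → E →L[ℂ] E) :
    ampliation F (∑ i ∈ s, A i) = ∑ i ∈ s, ampliation F (A i) :=
  htensor_ext fun x y => by
    rw [ampliation_htmul, _root_.sum_apply, _root_.sum_apply, ← htmulRight_apply, map_sum]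
    simp only [ampliation_htmul, htmulRight_apply]

lemma ampliation_smul (c : ℂ) (A : E →L[ℂ] E) :
    ampliation F (c • A) = c • ampliation F A :=
  htensor_ext fun x y => by
    rw [ampliation_htmul, _root_.smul_apply, _root_.smul_apply, ← htmulRight_apply, map_smul,
      ampliation_htmul, htmulRight_apply]

lemma ampliation_adjoint [CompleteSpace E] (A : E →L[ℂ] E) :
    ampliation F (ContinuousLinearMap.adjoint A) =
      ContinuousLinearMap.adjoint (ampliation F A) := by
  refine htensor_ext fun x y => ?_
  refine ext_inner_right ℂ fun z => ?_
  suffices h : innerSL ℂ (ampliation F (ContinuousLinearMap.adjoint A) (htmul x y)) =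
      innerSL ℂ (ContinuousLinearMap.adjoint (ampliation F A) (htmul x y)) from
    congrArg (fun u => u z) h
  refine htensor_ext fun x' y' => ?_
  simp only [innerSL_apply_apply, ContinuousLinearMap.adjoint_inner_left, ampliation_htmul,
    inner_htmul]

/-- An operator on `F²(H_n) ⊗ F` is determined by its values on the vectors `e_α ⊗ y`. -/
lemma fock_htensor_ext {f g : HTensor (Fock n) F →L[ℂ] G}
    (h : ∀ α y, f (htmul (fockBasis α) y) = g (htmul (fockBasis α) y)) : f = g := by
  classical
  refine htensor_ext fun x y => ?_
  have : f ∘L htmulRight (Fock n) y = g ∘L htmulRight (Fock n) y := by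
    refine lp.ext_continuousLinearMap (by norm_num) fun α => ?_
    ext
    exact h α y
  exact congrArg (fun u => u x) this

end HTensor

/-! ### The map `Φ_{p,T}` and the Poisson kernel -/

section Poisson

variable {H : Type*} [NormedAddCommGroup H] [InnerProductSpace ℂ H] [CompleteSpace H]
  (p : PosRegPoly n) (T : Fin n → H →L[ℂ] H)

lemma PosRegPoly.Phi_nonneg {X : H →L[ℂ] H} (hX : 0 ≤ X) : 0 ≤ p.Phi T X := by
  refine Finset.sum_nonneg fun α _ => ?_
  rw [ContinuousLinearMap.nonneg_iff_isPositive] at hX ⊢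
  refine ContinuousLinearMap.IsPositive.smul_of_nonneg (hX.conj_adjoint _) ?_
  exact_mod_cast p.coeff_nonneg α

lemma PosRegPoly.iterate_Phi_nonneg {X : H →L[ℂ] H} (hX : 0 ≤ X) (k : ℕ) :
    0 ≤ (p.Phi T)^[k] X := by
  induction k with
  | zero => exact hX
  | succ k ih =>
    rw [Function.iterate_succ_apply']
    exact p.Phi_nonneg T ih

lemma PosRegPoly.Phi_sub (X Y : H →L[ℂ] H) : p.Phi T (X - Y) = p.Phi T X - p.Phi T Y := by
  simp only [p.Phi_eq_polyMap, map_sub]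

lemma PosRegPoly.iterate_Phi_sub (X Y : H →L[ℂ] H) (k : ℕ) :
    (p.Phi T)^[k] (X - Y) = (p.Phi T)^[k] X - (p.Phi T)^[k] Y := by
  induction k with
  | zero => rfl
  | succ k ih => simp only [Function.iterate_succ_apply', ih, p.Phi_sub]

lemma PosRegPoly.inner_Phi_adjoint_comp_self {G : Type*} [NormedAddCommGroup G]
    [InnerProductSpace ℂ G] [CompleteSpace G] (A : H →L[ℂ] G) (h : H) :
    inner ℂ h (p.Phi T (ContinuousLinearMap.adjoint A ∘L A) h) =
      ((∑ γ ∈ p.toPoly.coeff.support,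
        p.a γ * ‖A (ContinuousLinearMap.adjoint (word T γ) h)‖ ^ 2 : ℝ) : ℂ) := by
  rw [PosRegPoly.Phi, _root_.sum_apply, inner_sum, Complex.ofReal_sum]
  refine Finset.sum_congr rfl fun γ _ => ?_
  rw [_root_.smul_apply, inner_smul_right, ContinuousLinearMap.comp_apply,
    ContinuousLinearMap.comp_apply, ContinuousLinearMap.comp_apply,
    ← ContinuousLinearMap.adjoint_inner_left, ContinuousLinearMap.adjoint_inner_right,
    inner_self_eq_norm_sq_to_K, Complex.ofReal_mul, Complex.ofReal_pow]
  rfl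

variable {T}

/-- The map `Φ_{p,T}` increases the trace at most by the factor `γ`. -/
lemma PosRegPoly.trace_Phi_le (hT : T ∈ p.domain H) {X : H →L[ℂ] H} (hX : 0 ≤ X) :
    trace (p.Phi T X) ≤ ENNReal.ofReal p.gamma * trace X := by
  have ha : ∀ α, 0 ≤ p.a α := p.coeff_nonneg
  have hpos : ∀ α, 0 ≤ word T α ∘L X ∘L ContinuousLinearMap.adjoint (word T α) := fun α => by
    rw [ContinuousLinearMap.nonneg_iff_isPositive] at hX ⊢
    exact hX.conj_adjoint _
  rw [PosRegPoly.Phi, trace_sum, PosRegPoly.gamma,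
    ENNReal.ofReal_sum_of_nonneg fun α _ =>
      div_nonneg (ha α) (p.b_nonneg α),
    Finset.sum_mul]
  · refine Finset.sum_le_sum fun α _ => ?_
    rw [trace_smul (ha α), div_eq_mul_one_div, ENNReal.ofReal_mul (ha α),
      mul_assoc]
    gcongr
    refine (trace_conj_le hX _).trans ?_
    gcongr
    exact p.norm_word_sq_le hT α
  · intro α _
    have h := (ContinuousLinearMap.nonneg_iff_isPositive _).1 (hpos α)
    rw [ContinuousLinearMap.nonneg_iff_isPositive]
    refine h.smul_of_nonneg ?_
    exact_mod_cast ha α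

variable (hT : T ∈ p.domain H)

lemma PosRegPoly.inner_htmul_poissonKernel (β : FreeMonoid (Fin n)) (y : p.defectSpace T)
    (h : H) :
    inner ℂ (htmul (fockBasis β) y) (p.poissonKernel T hT h) =
      (√(p.b β) : ℂ) *
        inner ℂ y (p.defectMap T (ContinuousLinearMap.adjoint (word T β) h)) := by
  have h1 := (p.hasSum_poissonKernel T hT h).mapL (innerSL ℂ (htmul (fockBasis β) y))
  have h2 := h1.unique (hasSum_single β fun α hα => by
    rw [innerSL_apply_apply, inner_smul_right, inner_htmul, inner_fockBasis hα.symm, zero_mul,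
      mul_zero])
  rw [innerSL_apply_apply, innerSL_apply_apply, inner_smul_right, inner_htmul,
    inner_self_eq_norm_sq_to_K, norm_fockBasis] at h2
  simpa using h2

/-- The Poisson kernel intertwines: `K^* (W_i ⊗ I) = T_i K^*`. -/
lemma PosRegPoly.adjoint_poissonKernel_comp_ampliation_W (i : Fin n) :
    ContinuousLinearMap.adjoint (p.poissonKernel T hT) ∘L ampliation (p.defectSpace T) (p.W i) =
      T i ∘L ContinuousLinearMap.adjoint (p.poissonKernel T hT) := by
  refine fock_htensor_ext fun β y => ext_inner_right ℂ fun h => ?_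
  have hb := (p.b_pos (FreeMonoid.of i * β)).ne'
  have hr : √(p.b β / p.b (FreeMonoid.of i * β)) * √(p.b (FreeMonoid.of i * β)) = √(p.b β) := by
    rw [← Real.sqrt_mul (div_nonneg (p.b_nonneg _) (p.b_nonneg _)), div_mul_cancel₀ _ hb]
  have hw : word T (FreeMonoid.of i) = T i := FreeMonoid.lift_eval_of T i
  rw [ContinuousLinearMap.comp_apply, ContinuousLinearMap.comp_apply,
    ContinuousLinearMap.adjoint_inner_left, ← ContinuousLinearMap.adjoint_inner_right (T i),
    ContinuousLinearMap.adjoint_inner_left, ampliation_htmul, p.W_fockBasis, ← htmulRight_apply,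
    map_smul, htmulRight_apply, inner_smul_left, p.inner_htmul_poissonKernel,
    p.inner_htmul_poissonKernel, adjoint_word_mul, hw, ← mul_assoc, Complex.conj_ofReal,
    ← Complex.ofReal_mul, hr]

lemma PosRegPoly.adjoint_poissonKernel_comp_ampliation_word (α : FreeMonoid (Fin n)) :
    ContinuousLinearMap.adjoint (p.poissonKernel T hT) ∘L
        ampliation (p.defectSpace T) (word p.W α) =
      word T α ∘L ContinuousLinearMap.adjoint (p.poissonKernel T hT) := by
  induction α using FreeMonoid.inductionOn' with
  | one =>
    simp only [word, map_one, ampliation_one]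
    rfl
  | of_mul i α ih =>
    simp only [word, map_mul, ampliation_mul, FreeMonoid.lift_eval_of] at ih ⊢
    rw [ContinuousLinearMap.mul_def, ← ContinuousLinearMap.comp_assoc,
      p.adjoint_poissonKernel_comp_ampliation_W, ContinuousLinearMap.comp_assoc, ih]
    rfl

/-- Compression by the Poisson kernel carries `Φ_{p,W} ⊗ id` to `Φ_{p,T}`. -/
lemma PosRegPoly.compression_Phi (X : Fock n →L[ℂ] Fock n) :
    ContinuousLinearMap.adjoint (p.poissonKernel T hT) ∘L
        ampliation (p.defectSpace T) (p.Phi p.W X) ∘L p.poissonKernel T hT =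
      p.Phi T (ContinuousLinearMap.adjoint (p.poissonKernel T hT) ∘L
        ampliation (p.defectSpace T) X ∘L p.poissonKernel T hT) := by
  have hint := p.adjoint_poissonKernel_comp_ampliation_word hT
  have hint' : ∀ α, ContinuousLinearMap.adjoint (ampliation (p.defectSpace T) (word p.W α)) ∘L
      p.poissonKernel T hT =
        p.poissonKernel T hT ∘L ContinuousLinearMap.adjoint (word T α) := fun α => by
    have := congrArg ContinuousLinearMap.adjoint (hint α)
    simpa only [ContinuousLinearMap.adjoint_comp, ContinuousLinearMap.adjoint_adjoint] using this
  simp only [PosRegPoly.Phi, ampliation_sum, ampliation_smul]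
  ext h
  simp only [ContinuousLinearMap.comp_apply, _root_.sum_apply, _root_.smul_apply, map_sum,
    map_smul, ← ContinuousLinearMap.mul_def, ampliation_mul, ampliation_adjoint,
    _root_.mul_apply_eq_comp]
  refine Finset.sum_congr rfl fun α _ => ?_
  congr 1
  have h1 := fun z => congrArg (fun u => u z) (hint α)
  have h2 := congrArg (fun u => u h) (hint' α)
  simp only [ContinuousLinearMap.comp_apply] at h1 h2
  rw [h1, h2]

lemma PosRegPoly.compression_iterate_Phi (k : ℕ) :
    ContinuousLinearMap.adjoint (p.poissonKernel T hT) ∘L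
        ampliation (p.defectSpace T) ((p.Phi p.W)^[k] 1) ∘L p.poissonKernel T hT =
      (p.Phi T)^[k]
        (ContinuousLinearMap.adjoint (p.poissonKernel T hT) ∘L p.poissonKernel T hT) := by
  induction k with
  | zero =>
    simp only [Function.iterate_zero_apply, ampliation_one]
    rfl
  | succ k ih => rw [Function.iterate_succ_apply', p.compression_Phi, ih,
      Function.iterate_succ_apply']

lemma PosRegPoly.hasSum_norm_poissonKernel_sq (h : H) :
    HasSum (fun α => p.b α *
        ‖p.defectMap T (ContinuousLinearMap.adjoint (word T α) h)‖ ^ 2)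
      (‖p.poissonKernel T hT h‖ ^ 2) := by
  have h1 := (p.hasSum_poissonKernel T hT h).norm.pow 2
  refine h1.congr fun s => ?_
  rw [norm_sum_sq_of_orthogonal]
  · refine Finset.sum_congr rfl fun α _ => ?_
    rw [norm_smul, norm_htmul, norm_fockBasis, one_mul, mul_pow, Complex.norm_real,
      Real.norm_eq_abs, sq_abs, Real.sq_sqrt (p.b_nonneg α)]
  · intro α β hne
    simp only [inner_smul_left, inner_smul_right, inner_htmul, inner_fockBasis hne, zero_mul,
      mul_zero]

/-- Splitting the series for `‖K h‖²` according to the first factor of each word: the terms with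
`|β| ≥ 1` add up to `⟨Φ_{p,T}(K^* K) h, h⟩`, and `β = g_0` contributes `‖Δ h‖²`. -/
lemma PosRegPoly.norm_poissonKernel_sq (h : H) :
    ‖p.poissonKernel T hT h‖ ^ 2 = ‖p.defectMap T h‖ ^ 2 + ∑ γ ∈ p.toPoly.coeff.support,
      p.a γ * ‖p.poissonKernel T hT (ContinuousLinearMap.adjoint (word T γ) h)‖ ^ 2 := by
  classical
  set f : FreeMonoid (Fin n) → ℝ := fun β =>
    ‖p.defectMap T (ContinuousLinearMap.adjoint (word T β) h)‖ ^ 2 with hf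
  -- The series for `T_γ^* h`, reindexed by `δ ↦ γ δ` and extended by zero to all words.
  have hγ : ∀ γ, HasSum (fun β => p.bShift γ β * f β)
      (‖p.poissonKernel T hT (ContinuousLinearMap.adjoint (word T γ) h)‖ ^ 2) := by
    intro γ
    rw [← (mul_right_injective γ).hasSum_iff]
    · refine (p.hasSum_norm_poissonKernel_sq hT _).congr fun s => ?_
      refine Finset.sum_congr rfl fun δ _ => ?_
      simp only [Function.comp_apply, p.bShift_mul, hf, adjoint_word_mul]
    · intro β hβ
      rw [p.bShift_eq_zero fun δ hδ => hβ ⟨δ, hδ⟩, zero_mul]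
  have h1 : HasSum (fun β : FreeMonoid (Fin n) => if β = 1 then f 1 else 0) (f 1) :=
    hasSum_ite_eq 1 (f 1)
  have h2 : HasSum (fun β => ∑ γ ∈ p.toPoly.coeff.support, p.a γ * (p.bShift γ β * f β))
      (∑ γ ∈ p.toPoly.coeff.support,
        p.a γ * ‖p.poissonKernel T hT (ContinuousLinearMap.adjoint (word T γ) h)‖ ^ 2) :=
    hasSum_sum fun γ _ => (hγ γ).mul_left (p.a γ)
  have h3 : f 1 = ‖p.defectMap T h‖ ^ 2 := by
    simp [hf, word, ← ContinuousLinearMap.star_eq_adjoint]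
  rw [← h3]
  refine (p.hasSum_norm_poissonKernel_sq hT h).unique ((h1.add h2).congr fun s => ?_)
  refine Finset.sum_congr rfl fun β _ => ?_
  simp only [← mul_assoc, ← Finset.sum_mul]
  by_cases hβ : β = 1
  · subst hβ
    rw [if_pos rfl, Finset.sum_eq_zero fun γ hγ => by rw [p.bShift_one hγ, mul_zero], p.b_one]
    ring
  · rw [if_neg hβ, p.sum_a_mul_bShift hβ, zero_add]

/-- `K^* K - Φ_{p,T}(K^* K) = Δ²`. -/
lemma PosRegPoly.adjoint_comp_poissonKernel_sub_Phi :
    ContinuousLinearMap.adjoint (p.poissonKernel T hT) ∘L p.poissonKernel T hT -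
        p.Phi T (ContinuousLinearMap.adjoint (p.poissonKernel T hT) ∘L p.poissonKernel T hT) =
      1 - p.Phi T 1 := by
  have hone : (1 : H →L[ℂ] H) = ContinuousLinearMap.adjoint (1 : H →L[ℂ] H) ∘L 1 := by
    rw [← ContinuousLinearMap.star_eq_adjoint, star_one]
    rfl
  have hΦ : ∀ h, inner ℂ h (p.Phi T 1 h) = ((∑ γ ∈ p.toPoly.coeff.support,
      p.a γ * ‖ContinuousLinearMap.adjoint (word T γ) h‖ ^ 2 : ℝ) : ℂ) := by
    intro h
    rw [hone, p.inner_Phi_adjoint_comp_self]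
    simp only [_root_.one_apply_eq_self]
  -- Over `ℂ` an operator is determined by its quadratic form.
  refine ContinuousLinearMap.coe_injective ((ext_inner_map _ _).1 fun h => ?_)
  refine (starRingEnd ℂ).injective ?_
  rw [inner_conj_symm, inner_conj_symm]
  simp only [ContinuousLinearMap.coe_coe, _root_.sub_apply, inner_sub_right,
    p.inner_Phi_adjoint_comp_self, hΦ, ContinuousLinearMap.comp_apply,
    ContinuousLinearMap.adjoint_inner_right, _root_.one_apply_eq_self, inner_self_eq_norm_sq_to_K]
  have h1 := p.norm_defectMap_sq hT h
  rw [_root_.sub_apply, inner_sub_right, hΦ, _root_.one_apply_eq_self, Complex.sub_re,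
    Complex.ofReal_re, inner_self_eq_norm_sq_to_K] at h1
  have h2 : ((((‖h‖ : ℝ) : ℂ)) ^ 2).re = ‖h‖ ^ 2 := by
    rw [← Complex.ofReal_pow, Complex.ofReal_re]
  have h3 := p.norm_poissonKernel_sq hT h
  have h4 : ‖p.poissonKernel T hT h‖ ^ 2 - ∑ γ ∈ p.toPoly.coeff.support,
      p.a γ * ‖p.poissonKernel T hT (ContinuousLinearMap.adjoint (word T γ) h)‖ ^ 2 =
      ‖h‖ ^ 2 - ∑ γ ∈ p.toPoly.coeff.support,
      p.a γ * ‖ContinuousLinearMap.adjoint (word T γ) h‖ ^ 2 := by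
    have h1' := h1.trans (congrArg₂ _ h2 rfl)
    linarith
  have h5 := congrArg Complex.ofReal h4
  rw [Complex.ofReal_sub, Complex.ofReal_sub, Complex.ofReal_pow, Complex.ofReal_pow] at h5
  exact h5

/-- By telescoping, `K^* [I - Φ_{p,W}^{k+1}(I) ⊗ I] K = ∑_{j ≤ k} Φ_{p,T}^j(Δ²)`. -/
lemma PosRegPoly.curvOp_eq_sum (k : ℕ) :
    p.curvOp T hT k = ∑ j ∈ Finset.range (k + 1), (p.Phi T)^[j] (1 - p.Phi T 1) := by
  simp only [← p.adjoint_comp_poissonKernel_sub_Phi hT, p.iterate_Phi_sub,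
    ← Function.iterate_succ_apply]
  rw [Finset.sum_range_sub', PosRegPoly.curvOp, ContinuousLinearMap.sub_comp,
    ContinuousLinearMap.comp_sub, p.compression_iterate_Phi hT]
  rfl

/-! ### The curvature -/

/-- With `t_j = trace Φ_{p,T}^j(Δ²)`, the quotients are `(∑_{j ≤ k} t_j) / (∑_{j ≤ k} γ^j)`. -/
lemma PosRegPoly.curvSeq_eq (k : ℕ) :
    p.curvSeq T hT k =
      (∑ j ∈ Finset.range (k + 1), trace ((p.Phi T)^[j] (1 - p.Phi T 1))) /
        ∑ j ∈ Finset.range (k + 1), ENNReal.ofReal p.gamma ^ j := by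
  have h0 : 0 ≤ 1 - p.Phi T 1 := sub_nonneg.2 ((p.mem_domain_iff T).1 hT)
  rw [PosRegPoly.curvSeq, p.curvOp_eq_sum, trace_sum _ fun j _ => p.iterate_Phi_nonneg T h0 j,
    ENNReal.ofReal_sum_of_nonneg fun j _ => pow_nonneg p.gamma_nonneg j]
  simp only [ENNReal.ofReal_pow p.gamma_nonneg]

lemma PosRegPoly.antitone_curvSeq : Antitone (p.curvSeq T hT) := by
  have h0 : 0 ≤ 1 - p.Phi T 1 := sub_nonneg.2 ((p.mem_domain_iff T).1 hT)
  have h := antitone_sum_div_geom_sum (t := fun j => trace ((p.Phi T)^[j] (1 - p.Phi T 1)))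
    (c := ENNReal.ofReal p.gamma) ENNReal.ofReal_ne_top fun j => by
      rw [Function.iterate_succ_apply']
      exact p.trace_Phi_le hT (p.iterate_Phi_nonneg T h0 j)
  intro k l hkl
  rw [p.curvSeq_eq, p.curvSeq_eq]
  exact h hkl

lemma PosRegPoly.tendsto_curvSeq : Tendsto (p.curvSeq T hT) atTop (𝓝 (p.curv T hT)) :=
  tendsto_nhds_limUnder ⟨_, tendsto_atTop_iInf (p.antitone_curvSeq hT)⟩

lemma PosRegPoly.curvSeq_zero : p.curvSeq T hT 0 = trace (1 - p.Phi T 1) := by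
  simp [p.curvSeq_eq]

lemma PosRegPoly.curvSeq_eq_top (h : trace (1 - p.Phi T 1) = ∞) (k : ℕ) :
    p.curvSeq T hT k = ∞ := by
  rw [p.curvSeq_eq, Finset.sum_range_succ', Function.iterate_zero_apply, h, add_top]
  exact ENNReal.top_div_of_ne_top
    (ENNReal.sum_ne_top.2 fun j _ => ENNReal.pow_ne_top ENNReal.ofReal_ne_top)

end Poisson

end NCDomain

end

theorem mainTheorem10 {n : ℕ} (hn : 1 ≤ n) {H : Type*} [NormedAddCommGroup H]
    [InnerProductSpace ℂ H] [CompleteSpace H] (p : PosRegPoly n) (T : Fin n → H →L[ℂ] H)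
    (hT : T ∈ p.domain H) :
    (∀ k, (p.curvOp T hT k).IsPositive) ∧
    Tendsto (p.curvSeq T hT) atTop (𝓝 (p.curv T hT)) ∧
    (p.curv T hT < ∞ ↔ trace (1 - p.Phi T 1) < ∞) ∧
    p.curv T hT ≤ trace (1 - p.Phi T 1) := by
  have hlim := p.tendsto_curvSeq hT
  have hle : p.curv T hT ≤ trace (1 - p.Phi T 1) := by
    rw [← p.curvSeq_zero hT]
    exact (p.antitone_curvSeq hT).le_of_tendsto hlim 0
  refine ⟨fun k => ?_, hlim, ⟨fun hlt => ?_, hle.trans_lt⟩, hle⟩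
  · rw [← ContinuousLinearMap.nonneg_iff_isPositive, p.curvOp_eq_sum]
    exact Finset.sum_nonneg fun j _ =>
      p.iterate_Phi_nonneg T (sub_nonneg.2 ((p.mem_domain_iff T).1 hT)) j
  · refine lt_top_iff_ne_top.2 fun htop => hlt.ne ?_
    refine tendsto_nhds_unique hlim (tendsto_const_nhds.congr fun k => ?_)
    exact (p.curvSeq_eq_top hT htop k).symm
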